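/- **Conventions.** Let $\mathfrak L$ be a countable relational language. A *smooth class* $(\mathcal C,\leqslant)$ is a class $\mathcal C$ of finite $\mathfrak L$-structures, closed under isomorphism and substructure and containing an empty structure, with a reflexive and transitive relation $\leqslant$ on $\mathcal C$, invariant under isomorphism, such that $A\leqslant B$ implies that $A$ is a substructure of $B$, and such that $A_1\leqslant A$ implies $A_1\cap A_2\leqslant A_2$ for all substructures $A_1,A_2$ of $A\in\mathcal C$. For a structure $N$ all of whose finite substructures are in $\mathcal C$, and a finite substructure $A$ of $N$, write $A\leqslant N$ if $A\leqslant T$ for every finite substructure $T$ of $N$ containing $A$. An embedding $\Gamma:A\to N$ is a *$\leqslant$-embedding* if $\Gamma(A)\leqslant N$; the images $\Gamma(A)$ of $\leqslant$-embeddings are the *closed copies* of $A$ in $N$, and $\mathrm{Emb}(N,A)$ denotes the set of $\leqslant$-embeddings of $A$ into $N$ taken up to their image, i.e. the set of closed copies of $A$ in $N$. *Amalgamation property*: for all $\leqslant$-embeddings $f:A\to B$, $g:A\to C$ in $\mathcal C$ there are $D\in\mathcal C$ and $\leqslant$-embeddings $f':B\to D$, $g':C\to D$ with $f'f=g'g$.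 A *$(\mathcal C,\leqslant)$-generic structure* is a countable structure $M$ such that: the finite structures embeddable in $M$ are exactly the members of $\mathcal C$; $M$ is the union of a chain $(A_i)_{i\in\omega}$ of finite $A_i\leqslant M$; and if $A\leqslant M$ is finite and $f:A\to B\in\mathcal C$ is a $\leqslant$-embedding, there is a $\leqslant$-embedding $\Lambda:B\to M$ with $\Lambda f=\mathrm{id}_A$. **Free pseudoplanes.** Let $A,B\in\mathcal C$ and $k\ge 2$. An *$A$-point* is a closed copy of $A$ in $M$. A *$B$-line* is a $\leqslant$-embedding $\Lambda:B\to M$; it is in $X\subseteq M$ if $\Lambda(B)\subseteq X$, and an $A$-point $P$ lies on $\Lambda$ if $P\subseteq\Lambda(B)$. Let $X\subseteq M$ be finite. For a set $R$ of $A$-points and a $B$-line $\Lambda$ in $X$, let $\mathcal I_R(\Lambda)$ be the set of $A$-points on $\Lambda$ that also lie on some $B$-line $\Lambda'\ne\Lambda$ in $X$ all of whose $A$-points belong to $R$; let $\mathcal H_R(\Lambda)$ be the set of $A$-points on $\Lambda$ not in $\mathcal I_R(\Lambda)$ if $|\mathcal I_R(\Lambda)|\le k$, and $\mathcal H_R(\Lambda)=\emptyset$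 otherwise. $(A;B)$ forms a *free $k$-pseudoplane in $X$* if the $B$-lines in $X$ have an enumeration $\Lambda_0,\dots,\Lambda_{b-1}$ such that, when $R_0$ is the set of all $A$-points contained in $X$ and $R_{i+1}=R_i\setminus\mathcal H_{R_i}(\Lambda_i)$, no element of $R_b$ lies on a $B$-line in $X$. It forms a *free $k$-pseudoplane* (in $M$) if it does so in every finite $X\subseteq M$. **Matrices.** A matrix $\mathrm X$ with $m$ rows, $n$ columns and entries in $\{0,1\}$ satisfies the *$k$-configuration exhibition condition* if $k\le n$ and for all columns $l_1<\dots<l_k$ and all $\sigma:\{1,\dots,k\}\to\{0,1\}$ there is a row $j$ with $x_{jl_i}=\sigma(i)$ for all $i$. It satisfies the *convex Ramsey condition* if there is a probability vector $\mathrm P=(p_1,\dots,p_m)$ with $\mathrm P\,\mathrm X\,\mathrm W\le\frac12$ for every column vector $\mathrm W$ with one entry $1$, one entry $-1$ and all other entries $0$. **Theorem.** Let $(\mathcal C,\leqslant)$ be a smooth class with the amalgamation property and let $M$ be its generic structure. Let $A,B\in\mathcal C$ be such that $B$ has at least one $\leqslant$-embedding into $M$ (this is automatic if $\emptyset\leqslant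 C$ for all $C\in\mathcal C$), $|\mathrm{Emb}(B,A)|=n$ and $(A;B)$ forms a free $2$-pseudoplane in $M$. Suppose that there is a $0/1$ matrix with $n$ columns and finitely many rows that satisfies the $2$-configuration exhibition condition but not the convex Ramsey condition. Then $\mathrm{Aut}(M)$, with the topology of pointwise convergence, is not amenable: some continuous action of $\mathrm{Aut}(M)$ on a nonempty compact Hausdorff space has no invariant Borel probability measure. -/

import Mathlib

open FirstOrder MeasureTheory
open scoped Matrix

universe u v w

/-! ### Automorphism groups and amenability -/

section Automorphisms

variable {L : FirstOrder.Language.{u, v}} {M : Type w} [L.Structure M]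

/-- The automorphism group of a structure, with composition as multiplication. -/
instance autGroup : Group (M ≃[L] M) where
  mul g h := g.comp h
  one := FirstOrder.Language.Equiv.refl L M
  inv g := g.symm
  mul_assoc _ _ _ := rfl
  one_mul _ := FirstOrder.Language.Equiv.ext fun _ => rfl
  mul_one _ := FirstOrder.Language.Equiv.ext fun _ => rfl
  inv_mul_cancel g := FirstOrder.Language.Equiv.ext fun x => g.toEquiv.symm_apply_apply x

/-- The topology of pointwise convergence on the automorphism group: the topology induced by
the product topology on `M → M`, where `M` is discrete. -/
instance autTopology : TopologicalSpace (M ≃[L] M) :=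
  TopologicalSpace.induced (fun g => (g : M → M))
    (@Pi.topologicalSpace M (fun _ => M) (fun _ => ⊥))

end Automorphisms

/-- A topological group is amenable if each of its continuous actions on a (nonempty) compact
Hausdorff space admits an invariant Borel probability measure. -/
def IsAmenable (G : Type w) [Group G] [TopologicalSpace G] : Prop :=
  ∀ (X : Type w) [TopologicalSpace X] [CompactSpace X] [T2Space X] [Nonempty X]
    [MulAction G X] [ContinuousSMul G X] [MeasurableSpace X] [BorelSpace X],
    ∃ μ : Measure X, IsProbabilityMeasure μ ∧ ∀ g : G, μ.map (fun x => g • x) = μ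

/-! ### Smooth classes and generic structures -/

/-- A smooth class: a class `mem` of finite structures, closed under isomorphism and
substructure and containing an empty structure, with a relation `≤` on it that refines the
substructure relation.  Here `closed B S` says that the substructure `S` of the structure `B`
satisfies `S ≤ B`; it is only meaningful for `B` in the class. -/
structure SmoothClass (L : FirstOrder.Language.{u, v}) where
  /-- membership in the class -/
  mem : ∀ (A : Type w) [L.Structure A], Prop
  /-- the relation `S ≤ B` -/
  closed : ∀ (B : Type w) [L.Structure B], L.Substructure B → Prop
  finite_of_mem : ∀ (A : Type w) [L.Structure A], mem A → Finite A
  mem_of_embedding : ∀ (A B : Type w) [L.Structure A] [L.Structure B],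
    (A ↪[L] B) → mem B → mem A
  exists_empty : ∃ (E : Type w) (_ : L.Structure E), IsEmpty E ∧ mem E
  closed_map : ∀ (A B : Type w) [L.Structure A] [L.Structure B] (e : A ≃[L] B)
    (S : L.Substructure A), mem A → closed A S → closed B (S.map e.toHom)
  closed_top : ∀ (A : Type w) [L.Structure A], mem A → closed A ⊤
  closed_trans : ∀ (A : Type w) [L.Structure A] (S T : L.Substructure A), mem A → S ≤ T →
    closed T (S.comap T.subtype.toHom) → closed A T → closed A S
  closed_inter : ∀ (A : Type w) [L.Structure A] (S T : L.Substructure A), mem A →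
    closed A S → closed T (S.comap T.subtype.toHom)

namespace SmoothClass

variable {L : FirstOrder.Language.{u, v}} (K : SmoothClass.{u, v, w} L)

/-- `S ≤ N` for a structure `N`, possibly infinite, all of whose finite substructures are in the
class: `S ≤ T` for each finite substructure `T` of `N` that contains `S`. -/
def IsClosedIn (N : Type w) [L.Structure N] (S : L.Substructure N) : Prop :=
  ∀ T : L.Substructure N, Finite T → S ≤ T → K.closed T (S.comap T.subtype.toHom)

/-- On members of the class, `IsClosedIn` is the relation that the class comes with. -/
theorem isClosedIn_iff_closed {B : Type w} [L.Structure B] (hB : K.mem B)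
    (S : L.Substructure B) : K.IsClosedIn B S ↔ K.closed B S := by
  constructor
  · intro h
    have := K.finite_of_mem B hB
    have h1 := h ⊤ inferInstance le_top
    exact K.closed_trans B S ⊤ hB le_top h1 (K.closed_top B hB)
  · intro h T _ _
    exact K.closed_inter B S T hB h

/-- The set of `≤`-embeddings of `A` into `N`. -/
def Emb (A N : Type w) [L.Structure A] [L.Structure N] : Set (A ↪[L] N) :=
  {Γ | K.IsClosedIn N Γ.toHom.range}

/-- The set of `≤`-closed copies of `A` in `N`: the images of the `≤`-embeddings of `A`
into `N`. -/
def Copies (A N : Type w) [L.Structure A] [L.Structure N] : Set (L.Substructure N) :=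
  (fun Γ : A ↪[L] N => Γ.toHom.range) '' K.Emb A N

/-- The amalgamation property. -/
def AmalgamationProperty : Prop :=
  ∀ (A B C : Type w) [L.Structure A] [L.Structure B] [L.Structure C],
    K.mem A → K.mem B → K.mem C → ∀ f ∈ K.Emb A B, ∀ g ∈ K.Emb A C,
      ∃ (D : Type w) (_ : L.Structure D), K.mem D ∧
        ∃ f' ∈ K.Emb B D, ∃ g' ∈ K.Emb C D, f'.comp f = g'.comp g

/-- `M` is the generic structure of the class. -/
structure IsGeneric (M : Type w) [L.Structure M] : Prop where
  countable : Countable M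
  /-- the age of `M` is the class -/
  age : ∀ (A : Type w) [L.Structure A], K.mem A ↔ Finite A ∧ Nonempty (A ↪[L] M)
  /-- `M` is the union of a chain of finite `≤`-closed substructures -/
  chain : ∃ F : ℕ → L.Substructure M, Monotone F ∧
    (∀ i, Finite (F i) ∧ K.IsClosedIn M (F i)) ∧ ∀ x : M, ∃ i, x ∈ F i
  /-- if `S ≤ M` is finite and `S ≤ B` with `B` in the class, then `B` has a `≤`-embedding
  into `M` over `S` -/
  extension : ∀ (S : L.Substructure M) (B : Type w) [L.Structure B], Finite S →
    K.IsClosedIn M S → K.mem B → ∀ f ∈ K.Emb S B, ∃ Λ ∈ K.Emb B M, Λ.comp f = S.subtype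

/-! ### Free pseudoplanes -/

section Pseudoplane

variable (k : ℕ) (A : Type w) {B M : Type w} [L.Structure A] [L.Structure B] [L.Structure M]

/-- The `A`-points that lie on `Λ`. -/
def PointsOn (Λ : B ↪[L] M) : Set (L.Substructure M) :=
  {P | P ∈ K.Copies A M ∧ P ≤ Λ.toHom.range}

variable (B) in
/-- The `B`-lines that are contained in `X`. -/
def Lines (X : L.Substructure M) : Set (B ↪[L] M) :=
  {Λ | Λ ∈ K.Emb B M ∧ Λ.toHom.range ≤ X}

/-- The `A`-points on `Λ` that lie on another `B`-line in `X`, one all of whose `A`-points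
belong to the set `R`. -/
def SharedPoints (X : L.Substructure M) (R : Set (L.Substructure M)) (Λ : B ↪[L] M) :
    Set (L.Substructure M) :=
  {P | P ∈ K.PointsOn A Λ ∧
    ∃ Λ' ∈ K.Lines B X, Λ' ≠ Λ ∧ K.PointsOn A Λ' ⊆ R ∧ P ≤ Λ'.toHom.range}

/-- The `A`-points on `Λ` that are not shared, if at most `k` of them are shared; the empty set
otherwise. -/
def FreePart (X : L.Substructure M) (R : Set (L.Substructure M)) (Λ : B ↪[L] M) :
    Set (L.Substructure M) :=
  {P | (K.SharedPoints A X R Λ).encard ≤ k ∧ P ∈ K.PointsOn A Λ ∧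
    P ∉ K.SharedPoints A X R Λ}

/-- The set of `A`-points that remains of `R` after the free parts of the lines in a list
are deleted, one line after the other. -/
def Remaining (X : L.Substructure M) : Set (L.Substructure M) → List (B ↪[L] M) →
    Set (L.Substructure M)
  | R, [] => R
  | R, Λ :: l => Remaining X (R \ K.FreePart k A X R Λ) l

variable (B) in
/-- `(A; B)` forms a free `k`-pseudoplane in the finite substructure `X` of `M`: for some
enumeration of the `B`-lines in `X`, the deletion process that starts from all `A`-points in `X`
deletes every `A`-point that lies on a `B`-line in `X`. -/
def IsFreePseudoplaneIn (X : L.Substructure M) : Prop :=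
  ∃ l : List (B ↪[L] M), l.Nodup ∧ (∀ Λ, Λ ∈ l ↔ Λ ∈ K.Lines B X) ∧
    ∀ Λ ∈ K.Lines B X,
      Disjoint (K.PointsOn A Λ) (K.Remaining k A X {P | P ∈ K.Copies A M ∧ P ≤ X} l)

variable (B M) in
/-- `(A; B)` forms a free `k`-pseudoplane in `M`. -/
def IsFreePseudoplane : Prop :=
  ∀ X : L.Substructure M, Finite X → K.IsFreePseudoplaneIn k A B X

end Pseudoplane

end SmoothClass

/-! ### Matrices -/

section Matrices

variable {m n : ℕ}

/-- All entries are `0` or `1`. -/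
def IsZeroOne (X : Matrix (Fin m) (Fin n) ℝ) : Prop :=
  ∀ i j, X i j = 0 ∨ X i j = 1

/-- One entry is `1`, one entry is `-1`, and all others are `0`. -/
def IsDiracWeight (W : Fin n → ℝ) : Prop :=
  ∃ i j, i ≠ j ∧ W i = 1 ∧ W j = -1 ∧ ∀ l, l ≠ i → l ≠ j → W l = 0

/-- The convex Ramsey condition. -/
def ConvexRamsey (X : Matrix (Fin m) (Fin n) ℝ) : Prop :=
  ∃ P : Fin m → ℝ, (∀ i, 0 ≤ P i) ∧ ∑ i, P i = 1 ∧
    ∀ W : Fin n → ℝ, IsDiracWeight W → (P ᵥ* X) ⬝ᵥ W ≤ 1 / 2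

/-- The `k`-configuration exhibition condition: in any `k` columns, each 0/1 pattern occurs in
some row. -/
def ExhibitsConfigurations (k : ℕ) (X : Matrix (Fin m) (Fin n) ℝ) : Prop :=
  k ≤ n ∧ ∀ σ : Fin k → ℝ, (∀ i, σ i = 0 ∨ σ i = 1) → ∀ l : Fin k → Fin n, StrictMono l →
    ∃ j, ∀ i, X j (l i) = σ i

end Matrices

/-! Number the closed copies of `A` in `B`. Every line then carries `n` numbered points, and
automorphisms of `M` permute the lines compatibly with the numbering. The 0/1 colorings of the
points whose pattern on every line is a row of the matrix form a compact space on which `Aut(M)`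
acts.

This space is nonempty: by compactness finitely many lines suffice, and these lie in a finite `X`.
Run the deletion process in `X` backwards. When the free part of a line returns, at most two of its
points are already constrained by other lines, and some row has the prescribed values there
(`exists_row`); the free points are colored by that row (`exists_coloring_of_remaining`).

If `Aut(M)` were amenable, an invariant probability measure would exist. By homogeneity
(`IsGeneric.exists_map_eq`) all points have color 1 with the same probability, so the law of the row
seen on one fixed line is a probability vector `p` with `p ᵥ* X` constant. Every weight in the
convex Ramsey condition then gives 0, contradicting its failure. -/

/-! ### Closed substructures of structures whose age is in the class -/

namespace SmoothClass

section Closed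

variable {L : FirstOrder.Language.{u, v}} (K : SmoothClass.{u, v, w} L)

theorem closed_of_equiv {A B : Type w} [L.Structure A] [L.Structure B] (e : A ≃[L] B)
    {S : L.Substructure A} {T : L.Substructure B} (hA : K.mem A) (hS : K.closed A S)
    (hT : ∀ x, e x ∈ T ↔ x ∈ S) : K.closed B T := by
  have : T = S.map e.toHom := by
    ext y
    obtain ⟨x, rfl⟩ := e.surjective y
    rw [hT]
    constructor
    · exact fun h => ⟨x, h, rfl⟩
    · rintro ⟨x', h, hx⟩
      rwa [← e.injective hx]
  rw [this]
  exact K.closed_map A B e S hA hS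

theorem closed_comap {A B : Type w} [L.Structure A] [L.Structure B] (f : A ↪[L] B)
    {S : L.Substructure B} (hB : K.mem B) (hS : K.closed B S) : K.closed A (S.comap f.toHom) := by
  refine K.closed_of_equiv f.equivRange.symm
    (K.mem_of_embedding _ _ (FirstOrder.Language.Substructure.subtype _) hB)
    (K.closed_inter B S f.toHom.range hB hS) fun x => ?_
  obtain ⟨y, rfl⟩ := f.equivRange.surjective x
  rw [FirstOrder.Language.Equiv.symm_apply_apply]
  rfl

theorem closed_map_of_closed_range {A B : Type w} [L.Structure A] [L.Structure B] (f : A ↪[L] B)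
    {S : L.Substructure A} (hB : K.mem B) (hf : K.closed B f.toHom.range) (hS : K.closed A S) :
    K.closed B (S.map f.toHom) := by
  refine K.closed_trans B _ f.toHom.range hB FirstOrder.Language.Hom.map_le_range ?_ hf
  refine K.closed_of_equiv f.equivRange (K.mem_of_embedding _ _ f hB) hS fun x => ?_
  constructor
  · rintro ⟨y, hy, hyx⟩
    rwa [← f.injective hyx]
  · exact fun h => ⟨x, h, rfl⟩

variable {M : Type w} [L.Structure M]

theorem finite_sup [L.IsRelational] (S T : L.Substructure M) [hS : Finite S] [hT : Finite T] :
    Finite ↥(S ⊔ T) := by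
  rw [← FirstOrder.Language.Substructure.fg_iff_finite] at *
  exact hS.sup hT

theorem finite_range {A : Type w} [L.Structure A] [Finite A] (f : A ↪[L] M) :
    Finite f.toHom.range :=
  Finite.of_equiv A f.equivRange.toEquiv

/-- All finite substructures of `M` are in the class. -/
def AgeIn (M : Type w) [L.Structure M] : Prop :=
  ∀ S : L.Substructure M, Finite S → K.mem S

variable {K}

theorem IsGeneric.ageIn (hM : K.IsGeneric M) : K.AgeIn M :=
  fun S hS => (hM.age S).2 ⟨hS, ⟨S.subtype⟩⟩

theorem IsClosedIn.comap [L.IsRelational] (hM : K.AgeIn M) {A : Type w} [L.Structure A] [Finite A]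
    (f : A ↪[L] M) {S : L.Substructure M} [Finite S] (hS : K.IsClosedIn M S) :
    K.closed A (S.comap f.toHom) := by
  have := finite_range f
  have := finite_sup S f.toHom.range
  exact K.closed_comap (f.codRestrict (S ⊔ f.toHom.range)
    fun a => (le_sup_right : f.toHom.range ≤ S ⊔ f.toHom.range) ⟨a, rfl⟩)
    (hM _ this) (hS _ this le_sup_left)

/-- A test substructure `T` need not contain the range of `Λ`. Transitivity is applied in the finite
join of the two, and the intersection axiom brings the result back to `T`. -/
theorem isClosedIn_map_of_mem_emb [L.IsRelational] (hM : K.AgeIn M) {B : Type w} [L.Structure B]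
    [Finite B] {Λ : B ↪[L] M} (hΛ : Λ ∈ K.Emb B M) {S : L.Substructure B} (hS : K.closed B S) :
    K.IsClosedIn M (S.map Λ.toHom) := by
  intro T hT hST
  have := finite_range Λ
  have hfin := finite_sup T Λ.toHom.range
  let Λ' : B ↪[L] ↥(T ⊔ Λ.toHom.range) := Λ.codRestrict (T ⊔ Λ.toHom.range)
    fun a => (le_sup_right : Λ.toHom.range ≤ T ⊔ Λ.toHom.range) ⟨a, rfl⟩
  have hr : Λ'.toHom.range
      = Λ.toHom.range.comap (T ⊔ Λ.toHom.range).subtype.toHom := by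
    ext x
    exact ⟨fun ⟨y, hy⟩ => ⟨y, congrArg Subtype.val hy⟩, fun ⟨y, hy⟩ => ⟨y, Subtype.ext hy⟩⟩
  have h1 : K.closed _ Λ'.toHom.range := by
    rw [hr]
    exact hΛ _ hfin le_sup_right
  have h2 := K.closed_comap (FirstOrder.Language.Substructure.inclusion
    (le_sup_left : T ≤ T ⊔ Λ.toHom.range)) (hM _ hfin)
    (K.closed_map_of_closed_range Λ' (hM _ hfin) h1 hS)
  convert h2 using 1
  ext x
  exact ⟨fun ⟨y, hy, hyx⟩ => ⟨y, hy, Subtype.ext hyx⟩,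
    fun ⟨y, hy, hyx⟩ => ⟨y, hy, congrArg Subtype.val hyx⟩⟩

theorem IsClosedIn.map_equiv [L.IsRelational] (hM : K.AgeIn M) (g : M ≃[L] M)
    {S : L.Substructure M} [Finite S] (hS : K.IsClosedIn M S) :
    K.IsClosedIn M (S.map g.toHom) := by
  intro T hT _
  have := hS.comap hM (g.symm.toEmbedding.comp T.subtype)
  convert this using 1
  ext x
  constructor
  · rintro ⟨y, hy, hyx⟩
    change g.symm (x : M) ∈ S
    have : g y = x := hyx
    rw [← this, FirstOrder.Language.Equiv.symm_apply_apply]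
    exact hy
  · intro h
    exact ⟨g.symm (x : M), h, g.apply_symm_apply (x : M)⟩

theorem comp_mem_emb [L.IsRelational] (hM : K.AgeIn M) (g : M ≃[L] M) {A : Type w}
    [L.Structure A] [Finite A] {Γ : A ↪[L] M} (hΓ : Γ ∈ K.Emb A M) :
    g.toEmbedding.comp Γ ∈ K.Emb A M := by
  have := finite_range Γ
  have h := IsClosedIn.map_equiv hM g hΓ
  rwa [← FirstOrder.Language.Hom.range_comp] at h

theorem map_mem_copies [L.IsRelational] (hM : K.AgeIn M) (g : M ≃[L] M) {A : Type w}
    [L.Structure A] [Finite A] {S : L.Substructure M} (hS : S ∈ K.Copies A M) :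
    S.map g.toHom ∈ K.Copies A M := by
  obtain ⟨Γ, hΓ, rfl⟩ := hS
  exact ⟨_, comp_mem_emb hM g hΓ, FirstOrder.Language.Hom.range_comp Γ.toHom g.toHom⟩

theorem map_mem_copies_of_mem_emb [L.IsRelational] (hM : K.AgeIn M) {A B : Type w}
    [L.Structure A] [L.Structure B] (hB : K.mem B) {Λ : B ↪[L] M}
    (hΛ : Λ ∈ K.Emb B M) {S : L.Substructure B} (hS : S ∈ K.Copies A B) :
    S.map Λ.toHom ∈ K.Copies A M := by
  have := K.finite_of_mem B hB
  obtain ⟨Γ, hΓ, rfl⟩ := hS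
  refine ⟨Λ.comp Γ, ?_, FirstOrder.Language.Hom.range_comp Γ.toHom Λ.toHom⟩
  have h := isClosedIn_map_of_mem_emb hM hΛ ((K.isClosedIn_iff_closed hB _).1 hΓ)
  rwa [← FirstOrder.Language.Hom.range_comp] at h

/-- With the preceding lemma, this matches the points on a line with the closed copies of `A` in
`B`. Closedness pulls back along `Λ` by the intersection axiom. -/
theorem exists_map_eq_of_mem_copies [L.IsRelational] (hM : K.AgeIn M) {A B : Type w}
    [L.Structure A] [L.Structure B] (hA : K.mem A) (hB : K.mem B) (Λ : B ↪[L] M)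
    {P : L.Substructure M} (hP : P ∈ K.Copies A M) (hPΛ : P ≤ Λ.toHom.range) :
    ∃ S ∈ K.Copies A B, S.map Λ.toHom = P := by
  have := K.finite_of_mem B hB
  have := K.finite_of_mem A hA
  obtain ⟨Γ, hΓ, rfl⟩ := hP
  have := finite_range Γ
  let Γ' : A ↪[L] B := Λ.equivRange.symm.toEmbedding.comp
    (Γ.codRestrict Λ.toHom.range fun a => hPΛ ⟨a, rfl⟩)
  have hΓ' : ∀ a, Λ (Γ' a) = Γ a := fun a =>
    congrArg Subtype.val (Λ.equivRange.apply_symm_apply ⟨Γ a, hPΛ ⟨a, rfl⟩⟩)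
  refine ⟨Γ'.toHom.range, ⟨Γ', ?_, rfl⟩, ?_⟩
  · refine (K.isClosedIn_iff_closed hB _).2 ?_
    have h := IsClosedIn.comap hM Λ hΓ
    convert h using 1
    ext x
    constructor
    · rintro ⟨a, rfl⟩
      exact ⟨a, (hΓ' a).symm⟩
    · rintro ⟨a, ha⟩
      exact ⟨a, Λ.injective ((hΓ' a).trans ha)⟩
  · rw [← FirstOrder.Language.Hom.range_comp]
    ext x
    exact ⟨fun ⟨a, ha⟩ => ⟨a, (hΓ' a).symm.trans ha⟩, fun ⟨a, ha⟩ => ⟨a, (hΓ' a).trans ha⟩⟩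

end Closed

/-! ### Homogeneity of the generic structure -/

section Homogeneity

variable {L : FirstOrder.Language.{u, v}} {K : SmoothClass.{u, v, w} L} {M : Type w}
  [L.Structure M]

theorem IsGeneric.exists_closed_ge (hM : K.IsGeneric M) (S : L.Substructure M) [Finite S] (x : M) :
    ∃ C : L.Substructure M, Finite C ∧ K.IsClosedIn M C ∧ S ≤ C ∧ x ∈ C := by
  obtain ⟨F, hmono, hF, hcov⟩ := hM.chain
  choose i hi using hcov
  obtain ⟨N, hN⟩ := (Set.finite_range fun s : S => i s).bddAbove
  refine ⟨F (max N (i x)), (hF _).1, (hF _).2, fun s hs => ?_, hmono (le_max_right _ _) (hi x)⟩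
  exact hmono ((hN ⟨⟨s, hs⟩, rfl⟩).trans (le_max_left _ _)) (hi s)

variable (K M) in
/-- The isomorphisms between finite closed substructures of `M`. -/
abbrev ClosedPartialEquiv : Type w :=
  {p : M ≃ₚ[L] M // Finite p.dom ∧ K.IsClosedIn M p.dom ∧ K.IsClosedIn M p.cod}

namespace ClosedPartialEquiv

theorem finite_cod (p : ClosedPartialEquiv K M) : Finite p.1.cod :=
  have := p.2.1
  Finite.of_equiv _ p.1.toEquiv.toEquiv

/-- The inverse of an isomorphism between finite closed substructures. -/
def symm (p : ClosedPartialEquiv K M) : ClosedPartialEquiv K M :=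
  ⟨p.1.symm, p.finite_cod, p.2.2.2, p.2.2.1⟩

/-- The "forth" step: a closed finite `C` containing the domain and `x` is re-embedded over the
codomain by the extension property, applied to the inverse isomorphism. "Back" is the same for
inverses. -/
theorem exists_ge_mem_dom (hM : K.IsGeneric M) (p : ClosedPartialEquiv K M) (x : M) :
    ∃ q : ClosedPartialEquiv K M, x ∈ q.1.dom ∧ p ≤ q := by
  obtain ⟨⟨dom, cod, e⟩, hfin, hdom, hcod⟩ := p
  dsimp only at hfin hdom hcod
  have hfin' : Finite cod := Finite.of_equiv _ e.toEquiv
  obtain ⟨C, hC, hCcl, hle, hx⟩ := hM.exists_closed_ge dom x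
  let f : cod ↪[L] C :=
    (FirstOrder.Language.Substructure.inclusion hle).comp e.symm.toEmbedding
  have hf : f ∈ K.Emb cod C := by
    refine (K.isClosedIn_iff_closed (hM.ageIn C hC) _).2 ?_
    convert hdom C hC hle using 1
    ext y
    constructor
    · rintro ⟨z, rfl⟩
      exact (e.symm z).2
    · intro hy
      refine ⟨e ⟨y, hy⟩, Subtype.ext ?_⟩
      exact congrArg (fun z : dom => (z : M)) (e.symm_apply_apply ⟨(y : M), hy⟩)
  obtain ⟨Λ, hΛ, hΛf⟩ := hM.extension cod C hfin' hcod (hM.ageIn C hC) f hf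
  refine ⟨⟨⟨C, Λ.toHom.range, Λ.equivRange⟩, hC, hCcl, hΛ⟩, hx, hle, ?_⟩
  ext y
  have h := DFunLike.congr_fun hΛf (e y)
  have h' : f (e y) = FirstOrder.Language.Substructure.inclusion hle y :=
    congrArg (FirstOrder.Language.Substructure.inclusion hle) (e.symm_apply_apply y)
  rw [FirstOrder.Language.Embedding.comp_apply, h'] at h
  exact h

theorem exists_ge_mem_cod (hM : K.IsGeneric M) (p : ClosedPartialEquiv K M) (x : M) :
    ∃ q : ClosedPartialEquiv K M, x ∈ q.1.cod ∧ p ≤ q := by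
  obtain ⟨q, hq, hpq⟩ := exists_ge_mem_dom hM p.symm x
  exact ⟨q.symm, hq, FirstOrder.Language.PartialEquiv.symm_le_iff.1 hpq⟩

/-- Isomorphisms between finite closed substructures of the generic structure extend to
automorphisms. -/
theorem exists_equiv (hM : K.IsGeneric M) (p : ClosedPartialEquiv K M) :
    ∃ g : M ≃[L] M, ∀ x : p.1.dom, g x = p.1.toEquiv x := by
  have := hM.countable
  have := Encodable.ofCountable M
  let D : M ⊕ M → Order.Cofinal (ClosedPartialEquiv K M) := fun s => Sum.recOn s
    (fun x => ⟨{q | x ∈ q.1.dom}, fun q => exists_ge_mem_dom hM q x⟩)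
    (fun x => ⟨{q | x ∈ q.1.cod}, fun q => exists_ge_mem_cod hM q x⟩)
  let S : ℕ →o M ≃ₚ[L] M :=
    ⟨Subtype.val ∘ Order.sequenceOfCofinals p D,
      (Subtype.mono_coe _).comp (Order.sequenceOfCofinals.monotone _ _)⟩
  have hdom : (FirstOrder.Language.DirectLimit.partialEquivLimit S).dom = ⊤ := by
    refine top_le_iff.1 fun x _ => ?_
    -- Stage 0 of the sequence is `p`, so the requirement with code `k` is met at stage `k + 1`.
    exact FirstOrder.Language.PartialEquiv.dom_le_dom
      (FirstOrder.Language.DirectLimit.le_partialEquivLimit S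
        (Encodable.encode (Sum.inl x : M ⊕ M) + 1))
      (Order.sequenceOfCofinals.encode_mem p D (Sum.inl x))
  have hcod : (FirstOrder.Language.DirectLimit.partialEquivLimit S).cod = ⊤ := by
    refine top_le_iff.1 fun x _ => ?_
    exact FirstOrder.Language.PartialEquiv.cod_le_cod
      (FirstOrder.Language.DirectLimit.le_partialEquivLimit S
        (Encodable.encode (Sum.inr x : M ⊕ M) + 1))
      (Order.sequenceOfCofinals.encode_mem p D (Sum.inr x))
  refine ⟨FirstOrder.Language.PartialEquiv.toEquivOfEqTop hdom hcod, fun x => ?_⟩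
  obtain ⟨h, h'⟩ := FirstOrder.Language.DirectLimit.le_partialEquivLimit S 0
  have h1 := DFunLike.congr_fun h' x
  have h2 := DFunLike.congr_fun
    (FirstOrder.Language.PartialEquiv.toEquivOfEqTop_toEmbedding hdom hcod) (x : M)
  refine Eq.trans h2 (Eq.trans ?_ h1)
  exact FirstOrder.Language.PartialEquiv.toEmbeddingOfEqTop_apply hdom (x : M)

end ClosedPartialEquiv

theorem IsGeneric.exists_map_eq (hM : K.IsGeneric M) {A : Type w} [L.Structure A] [Finite A]
    {P Q : L.Substructure M} (hP : P ∈ K.Copies A M) (hQ : Q ∈ K.Copies A M) :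
    ∃ g : M ≃[L] M, P.map g.toHom = Q := by
  obtain ⟨Γ, hΓ, rfl⟩ := hP
  obtain ⟨Δ, hΔ, rfl⟩ := hQ
  obtain ⟨g, hg⟩ := ClosedPartialEquiv.exists_equiv hM
    ⟨⟨Γ.toHom.range, Δ.toHom.range, Δ.equivRange.comp Γ.equivRange.symm⟩,
      finite_range Γ, hΓ, hΔ⟩
  have hgΓ : ∀ a, g (Γ a) = Δ a := fun a => by
    refine (hg (Γ.equivRange a)).trans ?_
    exact congrArg (fun b => Δ b) (Γ.equivRange.symm_apply_apply a)
  refine ⟨g, ?_⟩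
  ext x
  constructor
  · rintro ⟨_, ⟨a, rfl⟩, rfl⟩
    exact ⟨a, (hgΓ a).symm⟩
  · rintro ⟨a, rfl⟩
    exact ⟨Γ a, ⟨a, rfl⟩, hgΓ a⟩

end Homogeneity

end SmoothClass

/-! ### Colorings whose pattern on each line is a row of a matrix -/

section Colorings

/-- The colorings of the points whose restriction to each line is a row of `Y`. -/
def RowColorings {P E : Type*} {m n : ℕ} (pt : E → Fin n → P) (Y : Fin m → Fin n → Bool) :
    Set (P → Bool) :=
  {f | ∀ e, ∃ j, ∀ i, f (pt e i) = Y j i}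

variable {P : Type w} {E : Type*} {m n : ℕ} {pt : E → Fin n → P} {Y : Fin m → Fin n → Bool}

theorem isClosed_setOf_pattern (Y : Fin m → Fin n → Bool) (a : Fin n → P) :
    IsClosed {f : P → Bool | ∃ j, ∀ i, f (a i) = Y j i} := by
  have hc : Continuous fun (f : P → Bool) (i : Fin n) => f (a i) := by fun_prop
  have : {f : P → Bool | ∃ j, ∀ i, f (a i) = Y j i}
      = (fun (f : P → Bool) (i : Fin n) => f (a i)) ⁻¹' Set.range Y := by
    ext f
    exact ⟨fun ⟨j, hj⟩ => ⟨j, funext fun i => (hj i).symm⟩,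
      fun ⟨j, hj⟩ => ⟨j, fun i => (congrFun hj i).symm⟩⟩
  rw [this]
  exact (isClosed_discrete _).preimage hc

theorem isClosed_rowColorings : IsClosed (RowColorings pt Y) := by
  have : RowColorings pt Y = ⋂ e, {f : P → Bool | ∃ j, ∀ i, f (pt e i) = Y j i} := by
    ext f
    simp [RowColorings]
  rw [this]
  exact isClosed_iInter fun e => isClosed_setOf_pattern Y (pt e)

theorem rowColorings_nonempty
    (h : ∀ s : Finset E, ∃ f : P → Bool, ∀ e ∈ s, ∃ j, ∀ i, f (pt e i) = Y j i) :
    (RowColorings pt Y).Nonempty := by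
  have := CompactSpace.iInter_nonempty
    (t := fun e => {f : P → Bool | ∃ j, ∀ i, f (pt e i) = Y j i})
    (fun e => isClosed_setOf_pattern Y (pt e)) fun s => by
      obtain ⟨f, hf⟩ := h s
      exact ⟨f, by simpa using hf⟩
  obtain ⟨f, hf⟩ := this
  exact ⟨f, by simpa [RowColorings] using hf⟩

/-- The action on the colorings given by translation of the points. -/
abbrev rowColoringsAction {G : Type w} [Group G] [MulAction G P]
    (hpt : ∀ (g : G) e, ∃ e', ∀ i, pt e' i = g • pt e i) :
    MulAction G (RowColorings pt Y) where
  smul g f := ⟨fun p => f.1 (g⁻¹ • p), fun e => by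
    obtain ⟨e', he'⟩ := hpt g⁻¹ e
    obtain ⟨j, hj⟩ := f.2 e'
    exact ⟨j, fun i => (congrArg f.1 (he' i)).symm.trans (hj i)⟩⟩
  one_smul f := Subtype.ext (funext fun p => by
    change f.1 ((1 : G)⁻¹ • p) = f.1 p
    rw [inv_one, one_smul])
  mul_smul g h f := Subtype.ext (funext fun p => by
    change f.1 ((g * h)⁻¹ • p) = f.1 (h⁻¹ • g⁻¹ • p)
    rw [mul_inv_rev, mul_smul])

/-- An invariant measure on the colorings averages the rows of `Y` to a constant vector. -/
theorem IsAmenable.exists_convex_combination_const {G : Type w} [Group G] [TopologicalSpace G]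
    (hG : IsAmenable G) [MulAction G P] [MulAction.IsPretransitive G P]
    (hopen : ∀ p q : P, IsOpen {g : G | g • p = q}) [Nonempty E]
    (hpt : ∀ (g : G) e, ∃ e', ∀ i, pt e' i = g • pt e i)
    (h : ∀ s : Finset E, ∃ f : P → Bool, ∀ e ∈ s, ∃ j, ∀ i, f (pt e i) = Y j i) :
    ∃ p : Fin m → ℝ, (∀ j, 0 ≤ p j) ∧ ∑ j, p j = 1 ∧
      ∃ c : ℝ, ∀ i, ∑ j, p j * (if Y j i = true then 1 else 0) = c := by
  classical
  let := rowColoringsAction (Y := Y) hpt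
  have hsmul : ∀ (g : G) (f : RowColorings pt Y) (p : P), (g • f).1 p = f.1 (g⁻¹ • p) :=
    fun _ _ _ => rfl
  have : CompactSpace (RowColorings pt Y) :=
    isCompact_iff_compactSpace.1 isClosed_rowColorings.isCompact
  have : Nonempty (RowColorings pt Y) := (rowColorings_nonempty h).to_subtype
  have : ContinuousSMul G (RowColorings pt Y) := by
    refine ⟨Continuous.subtype_mk (continuous_pi fun p => ?_) _⟩
    refine continuous_iff_continuousAt.2 fun x => ?_
    -- For group elements near `x.1` the value at `p` is read off at the fixed point `x.1⁻¹ • p`, so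
    -- only a coordinate projection remains.
    have hU : {y : G × RowColorings pt Y | y.1 • (x.1⁻¹ • p) = p} ∈ nhds x :=
      ((hopen (x.1⁻¹ • p) p).preimage continuous_fst).mem_nhds (by simp)
    have hc : Continuous fun y : G × RowColorings pt Y => y.2.1 (x.1⁻¹ • p) :=
      (continuous_apply _).comp (continuous_subtype_val.comp continuous_snd)
    refine hc.continuousAt.congr (Filter.mem_of_superset hU fun y hy => ?_)
    change y.2.1 (x.1⁻¹ • p) = y.2.1 (y.1⁻¹ • p)
    rw [eq_inv_smul_iff.2 (Set.mem_ofPred.1 hy)]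
  let : MeasurableSpace (RowColorings pt Y) := borel _
  have : BorelSpace (RowColorings pt Y) := ⟨rfl⟩
  obtain ⟨μ, hμ, hinv⟩ := hG (RowColorings pt Y)
  have hmeas : ∀ p : P, MeasurableSet {f : RowColorings pt Y | f.1 p = true} := fun p =>
    ((isOpen_discrete ({true} : Set Bool)).preimage
      (f := fun f : RowColorings pt Y => f.1 p)
      ((continuous_apply p).comp continuous_subtype_val)).measurableSet
  have hconst : ∀ p q : P,
      μ.real {f : RowColorings pt Y | f.1 p = true} = μ.real {f | f.1 q = true} := by
    intro p q
    obtain ⟨g, rfl⟩ := MulAction.exists_smul_eq G p q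
    have hg : Measurable fun f : RowColorings pt Y => g • f :=
      (continuous_const_smul g).measurable
    conv_rhs => rw [← hinv g]
    rw [map_measureReal_apply hg (hmeas _)]
    congr 1
    ext f
    simp [hsmul]
  obtain ⟨e⟩ := ‹Nonempty E›
  -- Rows of `Y` may coincide, so the row index is chosen as a function of the pattern alone; this
  -- makes `J` continuous. On patterns that are not rows the index is arbitrary.
  have hrow : ∀ r : Fin n → Bool, ∃ j : Fin m, (∃ j, r = Y j) → r = Y j := by
    intro r
    by_cases hr : ∃ j, r = Y j
    · obtain ⟨j, hj⟩ := hr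
      exact ⟨j, fun _ => hj⟩
    · obtain ⟨f⟩ := ‹Nonempty (RowColorings pt Y)›
      exact ⟨(f.2 e).choose, fun h => absurd h hr⟩
  choose ρ hρ using hrow
  let J : RowColorings pt Y → Fin m := fun f => ρ fun i => f.1 (pt e i)
  have hJ : Measurable J := by
    have hc : Continuous fun (f : RowColorings pt Y) (i : Fin n) => f.1 (pt e i) :=
      continuous_pi fun i => (continuous_apply _).comp continuous_subtype_val
    exact (continuous_of_discreteTopology.comp hc : Continuous J).measurable
  have hJY : ∀ (f : RowColorings pt Y) i, f.1 (pt e i) = Y (J f) i := fun f i => by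
    obtain ⟨j, hj⟩ := f.2 e
    exact congrFun (hρ _ ⟨j, funext hj⟩) i
  have : IsProbabilityMeasure (μ.map J) := Measure.isProbabilityMeasure_map hJ.aemeasurable
  refine ⟨fun j => (μ.map J).real {j}, fun j => measureReal_nonneg, ?_, ?_⟩
  · rw [sum_measureReal_singleton, Finset.coe_univ, probReal_univ]
  · have hsum : ∀ i, ∑ j, (μ.map J).real {j} * (if Y j i = true then 1 else 0)
        = μ.real {f : RowColorings pt Y | f.1 (pt e i) = true} := by
      intro i
      simp only [mul_ite, mul_one, mul_zero]
      rw [← Finset.sum_filter, sum_measureReal_singleton,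
        map_measureReal_apply hJ (Finset.measurableSet _)]
      congr 1
      ext f
      simp [hJY]
    by_cases hn : Nonempty (Fin n)
    · obtain ⟨i₀⟩ := hn
      exact ⟨_, fun i => (hsum i).trans (hconst _ (pt e i₀))⟩
    · exact ⟨0, fun i => absurd ⟨i⟩ hn⟩

end Colorings

/-! ### Matrices that exhibit all configurations on two columns -/

section Configurations

variable {m n : ℕ}

/-- As `2 ≤ n`, the set `S` can be enlarged to exactly two columns, which are then put in increasing
order. -/
theorem ExhibitsConfigurations.exists_row {X : Matrix (Fin m) (Fin n) ℝ}
    (hX : ExhibitsConfigurations 2 X) {S : Set (Fin n)} (hS : S.encard ≤ 2) (c : Fin n → Bool) :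
    ∃ j, ∀ i ∈ S, decide (X j i = 1) = c i := by
  obtain ⟨T, hST, -, hT⟩ := Set.exists_superset_subset_encard_eq (Set.subset_univ S) hS
    (by simpa using hX.1)
  obtain ⟨x, y, hxy, rfl⟩ := Set.encard_eq_two.1 hT
  have key : ∀ x y : Fin n, x < y → ∃ j, ∀ i ∈ ({x, y} : Set (Fin n)),
      decide (X j i = 1) = c i := by
    intro x y hlt
    have hl : StrictMono ![x, y] := by
      intro a b hab
      fin_cases a <;> fin_cases b <;> simp_all
    obtain ⟨j, hj⟩ := hX.2 (fun k => if c (![x, y] k) = true then 1 else 0)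
      (fun i => by split_ifs <;> simp) ![x, y] hl
    refine ⟨j, fun i hi => ?_⟩
    have : ∃ k, ![x, y] k = i := by
      rcases hi with rfl | rfl
      exacts [⟨0, rfl⟩, ⟨1, rfl⟩]
    obtain ⟨k, rfl⟩ := this
    rw [hj k]
    by_cases h : c (![x, y] k) = true <;> simp [h]
  rcases lt_or_gt_of_ne hxy with hlt | hlt
  · obtain ⟨j, hj⟩ := key x y hlt
    exact ⟨j, fun i hi => hj i (hST hi)⟩
  · obtain ⟨j, hj⟩ := key y x hlt
    exact ⟨j, fun i hi => hj i (Set.pair_comm x y ▸ hST hi)⟩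

theorem convexRamsey_of_vecMul_const {X : Matrix (Fin m) (Fin n) ℝ} {p : Fin m → ℝ}
    (hp : ∀ j, 0 ≤ p j) (hp1 : ∑ j, p j = 1) {c : ℝ} (hc : ∀ i, (p ᵥ* X) i = c) :
    ConvexRamsey X := by
  refine ⟨p, hp, hp1, ?_⟩
  rintro W ⟨i, j, hij, hi, hj, h0⟩
  have hW : W = Pi.single i 1 - Pi.single j 1 := by
    ext l
    by_cases hli : l = i
    · subst hli
      simp [hi, hij]
    by_cases hlj : l = j
    · subst hlj
      simp [hj, hli]
    simp [h0 l hli hlj, hli, hlj]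
  rw [hW, dotProduct_sub, dotProduct_single_one, dotProduct_single_one, hc, hc, sub_self]
  norm_num

end Configurations

/-! ### Colorings of the points of a free pseudoplane -/

namespace SmoothClass

section Pseudoplane

variable {L : FirstOrder.Language.{u, v}} {K : SmoothClass.{u, v, w} L} {A B M : Type w}
  [L.Structure A] [L.Structure B] [L.Structure M] {m n : ℕ}

/-- If no line survives the deletion process, the points can be colored in the reverse order of
their deletion, so that the pattern on each line is a row of the matrix. -/
theorem exists_coloring_of_remaining {Y : Matrix (Fin m) (Fin n) ℝ}
    (hY : ExhibitsConfigurations 2 Y) {X : L.Substructure M}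
    {pt : (B ↪[L] M) → Fin n → L.Substructure M} (hinj : ∀ Λ, Function.Injective (pt Λ))
    (hpt : ∀ Λ ∈ K.Lines B X, K.PointsOn A Λ = Set.range (pt Λ)) (l : List (B ↪[L] M))
    (R : Set (L.Substructure M))
    (hl : ∀ Λ ∈ K.Lines B X, ¬ K.PointsOn A Λ ⊆ K.Remaining 2 A X R l) :
    ∃ f : L.Substructure M → Bool, ∀ Λ ∈ K.Lines B X, K.PointsOn A Λ ⊆ R →
      ∃ j, ∀ i, f (pt Λ i) = decide (Y j i = 1) := by
  classical
  induction l generalizing R with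
  -- No line has all its points in the final set, so nothing is required.
  | nil => exact ⟨fun _ => true, fun Λ hΛ hR => absurd hR (hl Λ hΛ)⟩
  | cons Λ₀ l ih =>
    obtain ⟨f, hf⟩ := ih (R \ K.FreePart 2 A X R Λ₀) hl
    -- A point of `Λ₀` on another line that is still intact is shared, hence not free.
    have hother : ∀ Λ ∈ K.Lines B X, Λ ≠ Λ₀ → K.PointsOn A Λ ⊆ R →
        Disjoint (K.PointsOn A Λ) (K.FreePart 2 A X R Λ₀) := by
      intro Λ hΛ hne hR
      rw [Set.disjoint_left]
      rintro P hP ⟨-, hP₀, hPs⟩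
      exact hPs ⟨hP₀, Λ, hΛ, hne, hR, hP.2⟩
    by_cases hΛ₀ : Λ₀ ∈ K.Lines B X ∧ (K.SharedPoints A X R Λ₀).encard ≤ 2
    · obtain ⟨hΛ₀, hcard⟩ := hΛ₀
      have hS : (pt Λ₀ ⁻¹' K.SharedPoints A X R Λ₀).encard ≤ 2 := by
        rw [← (hinj Λ₀).encard_image]
        exact (Set.encard_le_encard (Set.image_preimage_subset _ _)).trans hcard
      -- This row agrees with the coloring already made on the shared points of `Λ₀`; it dictates
      -- the colors of the free ones.
      obtain ⟨j, hj⟩ := hY.exists_row hS fun i => f (pt Λ₀ i)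
      refine ⟨fun P => if P ∈ K.FreePart 2 A X R Λ₀
        then decide (∃ i, pt Λ₀ i = P ∧ Y j i = 1) else f P, fun Λ hΛ hR => ?_⟩
      by_cases hne : Λ = Λ₀
      · subst hne
        refine ⟨j, fun i => ?_⟩
        have hi : pt Λ i ∈ K.PointsOn A Λ := hpt Λ hΛ ▸ ⟨i, rfl⟩
        dsimp only
        split_ifs with hfree
        · refine decide_eq_decide.2 ⟨?_, fun h => ⟨i, rfl, h⟩⟩
          rintro ⟨i', hi', h⟩
          rwa [← hinj Λ hi']
        · refine (hj i ?_).symm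
          by_contra hns
          exact hfree ⟨hcard, hi, hns⟩
      · have hd := hother Λ hΛ hne hR
        obtain ⟨j', hj'⟩ := hf Λ hΛ (Set.subset_sdiff.2 ⟨hR, hd⟩)
        refine ⟨j', fun i => ?_⟩
        have hi : pt Λ i ∈ K.PointsOn A Λ := hpt Λ hΛ ▸ ⟨i, rfl⟩
        dsimp only
        rw [if_neg (Set.disjoint_left.1 hd hi), hj']
    -- Either the free part is empty or `Λ₀` is not a line in `X`; in both cases no intact line
    -- loses a point, and `f` still works.
    · refine ⟨f, fun Λ hΛ hR => hf Λ hΛ (Set.subset_sdiff.2 ⟨hR, ?_⟩)⟩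
      by_cases hne : Λ = Λ₀
      · subst hne
        rw [Set.disjoint_right]
        exact fun P hP => absurd ⟨hΛ, hP.1⟩ hΛ₀
      · exact hother Λ hΛ hne hR

end Pseudoplane

section PointAction

variable {L : FirstOrder.Language.{u, v}} {K : SmoothClass.{u, v, w} L} {M : Type w}
  [L.Structure M]

/-- The action of the automorphism group on the closed copies of `A`. -/
abbrev copiesAction [L.IsRelational] (hM : K.AgeIn M) (A : Type w) [L.Structure A] [Finite A] :
    MulAction (M ≃[L] M) (K.Copies A M) where
  smul g S := ⟨S.1.map g.toHom, map_mem_copies hM g S.2⟩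
  one_smul S := Subtype.ext (FirstOrder.Language.Substructure.map_id S.1)
  mul_smul g h S := Subtype.ext (FirstOrder.Language.Substructure.map_map S.1 g.toHom h.toHom).symm

/-- The condition depends only on the restriction of `g` to the finite `S`, and the space of maps `S
→ M` is discrete. -/
theorem isOpen_setOf_map_eq (S T : L.Substructure M) [Finite S] :
    IsOpen {g : M ≃[L] M | S.map g.toHom = T} := by
  let : TopologicalSpace M := ⊥
  have : DiscreteTopology M := ⟨rfl⟩
  have hc : Continuous fun (g : M ≃[L] M) (s : S) => g s :=
    continuous_pi fun s => (continuous_apply (s : M)).comp continuous_induced_dom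
  have : {g : M ≃[L] M | S.map g.toHom = T}
      = (fun (g : M ≃[L] M) (s : S) => g s) ⁻¹' {φ | Set.range φ = T} := by
    ext g
    rw [Set.mem_ofPred, ← SetLike.coe_set_eq]
    have : ((S.map g.toHom : L.Substructure M) : Set M) = Set.range fun s : S => g s := by
      ext x
      constructor
      · rintro ⟨y, hy, rfl⟩
        exact ⟨⟨y, hy⟩, rfl⟩
      · rintro ⟨y, rfl⟩
        exact ⟨y, y.2, rfl⟩
    rw [this]
    rfl
  rw [this]
  exact (isOpen_discrete _).preimage hc

end PointAction

end SmoothClass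

theorem mainTheorem2 {L : FirstOrder.Language.{u, v}} [L.IsRelational]
    [Countable (Σ n, L.Relations n)] (K : SmoothClass.{u, v, w} L)
    (hAP : K.AmalgamationProperty) (M : Type w) [L.Structure M] (hM : K.IsGeneric M)
    (A B : Type w) [L.Structure A] [L.Structure B] (hA : K.mem A) (hB : K.mem B)
    (hBM : (K.Emb B M).Nonempty) (n : ℕ) (hn : (K.Copies A B).ncard = n)
    (hfree : K.IsFreePseudoplane 2 A B M)
    (m : ℕ) (X : Matrix (Fin m) (Fin n) ℝ) (hX01 : IsZeroOne X)
    (hX : ExhibitsConfigurations 2 X) (hXR : ¬ ConvexRamsey X) :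
    ¬ IsAmenable (M ≃[L] M) := by
  classical
  intro hG
  have hage := hM.ageIn
  have := K.finite_of_mem A hA
  have := K.finite_of_mem B hB
  have hn0 : 0 < n := lt_of_lt_of_le two_pos hX.1
  -- `ncard` is 0 on infinite sets, so a positive value gives finiteness.
  have hfin : Finite (K.Copies A B) := Set.finite_of_ncard_pos (by omega)
  obtain ⟨a⟩ : Nonempty (Fin n ≃ K.Copies A B) :=
    ⟨(Finite.equivFinOfCardEq hn).symm⟩
  let pt : (B ↪[L] M) → Fin n → L.Substructure M := fun Λ i => (a i).1.map Λ.toHom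
  have hinj : ∀ Λ, Function.Injective (pt Λ) := fun Λ i j hij =>
    a.injective (Subtype.ext
      (FirstOrder.Language.Substructure.map_injective_of_injective Λ.injective hij))
  have hpt : ∀ Λ ∈ K.Emb B M, K.PointsOn A Λ = Set.range (pt Λ) := by
    intro Λ hΛ
    ext P
    constructor
    · rintro ⟨hP, hPΛ⟩
      obtain ⟨S, hS, rfl⟩ := SmoothClass.exists_map_eq_of_mem_copies hage hA hB Λ hP hPΛ
      exact ⟨a.symm ⟨S, hS⟩, by simp [pt]⟩
    · rintro ⟨i, rfl⟩
      exact ⟨SmoothClass.map_mem_copies_of_mem_emb hage hB hΛ (a i).2,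
        FirstOrder.Language.Hom.map_le_range⟩
  let := SmoothClass.copiesAction hage A
  have : MulAction.IsPretransitive (M ≃[L] M) (K.Copies A M) := ⟨fun P Q => by
    obtain ⟨g, hg⟩ := hM.exists_map_eq P.2 Q.2
    exact ⟨g, Subtype.ext hg⟩⟩
  have hopen : ∀ P Q : K.Copies A M, IsOpen {g : M ≃[L] M | g • P = Q} := by
    rintro ⟨_, Γ, hΓ, rfl⟩ Q
    have := SmoothClass.finite_range Γ
    have h := SmoothClass.isOpen_setOf_map_eq Γ.toHom.range Q.1
    convert h using 1
    ext g
    exact Subtype.ext_iff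
  have : Nonempty (K.Emb B M) := hBM.to_subtype
  let ptc : K.Emb B M → Fin n → K.Copies A M := fun Λ i =>
    ⟨pt Λ.1 i, SmoothClass.map_mem_copies_of_mem_emb hage hB Λ.2 (a i).2⟩
  obtain ⟨p, hp, hp1, c, hc⟩ := hG.exists_convex_combination_const (pt := ptc)
    (Y := fun j i => decide (X j i = 1)) hopen
    (fun g Λ => ⟨⟨_, SmoothClass.comp_mem_emb hage g Λ.2⟩, fun i => Subtype.ext
      (FirstOrder.Language.Substructure.map_map (a i).1 g.toHom Λ.1.toHom).symm⟩)
    (fun s => by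
      obtain ⟨Z, hZ, hsZ⟩ : ∃ Z : L.Substructure M, Finite Z ∧
          ∀ Λ ∈ s, Λ.1.toHom.range ≤ Z := by
        refine ⟨s.sup fun Λ => Λ.1.toHom.range, ?_, fun Λ hΛ =>
          Finset.le_sup (f := fun Λ : K.Emb B M => Λ.1.toHom.range) hΛ⟩
        rw [← FirstOrder.Language.Substructure.fg_iff_finite]
        refine Finset.sup_induction FirstOrder.Language.Substructure.fg_bot
          (fun _ h _ h' => h.sup h') fun Λ _ => ?_
        exact FirstOrder.Language.Substructure.fg_iff_finite.2 (SmoothClass.finite_range Λ.1)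
      obtain ⟨l, -, -, hl⟩ := hfree Z hZ
      -- As `n > 0`, every line has a point, so a line disjoint from the remaining set is not
      -- contained in it.
      have hne : ∀ Λ ∈ K.Lines B Z, ¬ K.PointsOn A Λ ⊆
          K.Remaining 2 A Z {P | P ∈ K.Copies A M ∧ P ≤ Z} l := by
        intro Λ hΛ hsub
        have hmem : pt Λ ⟨0, hn0⟩ ∈ K.PointsOn A Λ := hpt Λ hΛ.1 ▸ ⟨_, rfl⟩
        exact Set.disjoint_left.1 (hl Λ hΛ) hmem (hsub hmem)
      obtain ⟨f, hf⟩ := SmoothClass.exists_coloring_of_remaining hX hinj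
        (fun Λ hΛ => hpt Λ hΛ.1) l _ hne
      exact ⟨fun P => f P.1, fun Λ hΛ => hf Λ.1 ⟨Λ.2, hsZ Λ hΛ⟩
        fun P hP => ⟨hP.1, hP.2.trans (hsZ Λ hΛ)⟩⟩)
  refine hXR (convexRamsey_of_vecMul_const hp hp1 (c := c) fun i => ?_)
  rw [← hc i]
  change ∑ j, p j * X j i = _
  refine Finset.sum_congr rfl fun j _ => ?_
  congr 1
  rcases hX01 j i with h | h <;> simp [h]
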